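/- Let $X$ be either the complex vector space $\mathbf{C}(\mathbb{R})$ of continuous functions $f:\mathbb{R}\to\mathbb{C}$ or the space of complex-valued Schwartz distributions on $\mathbb{R}$; a continuous function is regarded as a distribution via $f\{\phi\}=\int_{\mathbb{R}} f(t)\phi(t)\,dt$. For $h\in\mathbb{R}$ let $\tau_h$ be the translation operator on $X$, given by $(\tau_h f)(t)=f(t+h)$ for functions and $(\tau_h f)\{\phi\}=f\{\tau_{-h}\phi\}$ for distributions ($\phi$ a test function), and let $\Delta_h=\tau_h-1$ and $\Delta_h^m=(\Delta_h)^m$. A subspace $W$ is called translation invariant if $\tau_h(W)\subseteq W$ for every $h\in\mathbb{R}$. Let $m\ge 1$ be an integer and let $V$ be a finite-dimensional complex subspace of $X$ such that $\Delta_h^m(V)\subseteq V$ for every $h\in\mathbb{R}$. Then there exist complex vector spaces $P\subseteq\mathbb{C}[t]$ (polynomials regarded as functions on $\mathbb{R}$) and $E\subseteq\mathbf{C}(\mathbb{R})$ such that $V=P\oplus E$, $E$ is translation invariant, and $V$ is translation invariant if and only if $P$ is translation invariant. -/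

import Mathlib

open TopologicalSpace
open scoped Distributions

noncomputable section

namespace DeltaInvariant

/-- The space of complex-valued Schwartz distributions on `ℝ`. -/
abbrev Distr : Type := 𝓓'((⊤ : Opens ℝ), ℂ)

/-- The space of test functions on `ℝ`. -/
abbrev Test : Type := 𝓓((⊤ : Opens ℝ), ℝ)

/-- Translation of continuous functions, `(τ_h f)(t) = f (t + h)`. -/
def translateFun (h : ℝ) : Module.End ℂ C(ℝ, ℂ) where
  toFun f := ⟨fun t ↦ f (t + h), by fun_prop⟩
  map_add' _ _ := rfl
  map_smul' _ _ := rfl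

/-- Translation of test functions supported in a fixed compact set `K`, as a continuous linear map
into the test functions supported in `K - h`. -/
def translateSupportedIn (h : ℝ) (K : Compacts ℝ) :
    𝓓^{⊤}_{K}(ℝ, ℝ) →L[ℝ] 𝓓^{⊤}_{K.map (fun t ↦ t - h) (by fun_prop)}(ℝ, ℝ) :=
  ContDiffMapSupportedIn.mkCLM ℝ (fun φ t ↦ φ (t + h))
    (fun _ _ _ ↦ rfl) (fun _ _ _ ↦ rfl)
    (fun φ ↦ φ.contDiff.comp (by fun_prop))
    (fun φ t ht ↦ φ.zero_on_compl fun hK ↦ ht ⟨t + h, hK, by simp⟩)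
    (fun i hi ↦ ⟨{i}, 1, zero_le_one, fun φ t _ ↦ by
      rw [iteratedFDeriv_comp_add_right, Finset.sup_singleton, one_mul]
      exact ContDiffMapSupportedIn.norm_iteratedFDeriv_apply_le_seminorm ℝ (by simp)⟩)

/-- Translation of test functions, `(τ_h φ)(t) = φ (t + h)`, as a continuous linear map. -/
def translateTest (h : ℝ) : Test →L[ℝ] Test :=
  TestFunction.limitCLM ℝ
    (fun φ ↦ ⟨fun t ↦ φ (t + h), φ.contDiff.comp (by fun_prop),
      φ.hasCompactSupport.comp_homeomorph (Homeomorph.addRight h), fun _ _ ↦ trivial⟩)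
    (fun K _ ↦ (TestFunction.ofSupportedInCLM ℝ fun _ _ ↦ trivial) ∘L translateSupportedIn h K)
    (fun _ _ _ ↦ rfl)

/-- Translation of distributions, `(τ_h T){φ} = T{τ_{-h} φ}`. -/
def translateDistr (h : ℝ) : Module.End ℂ Distr where
  toFun T := (translateTest (-h)).precompCompactConvergenceCLM ℂ T
  map_add' _ _ := rfl
  map_smul' _ _ := rfl

/-- The regular distribution `φ ↦ ∫ φ(t) f(t) dt` of a continuous function `f`. -/
def regular (f : C(ℝ, ℂ)) : Distr :=
  (TestFunction.integralAgainstBilinCLM (ContinuousLinearMap.lsmul ℝ ℝ)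
    MeasureTheory.volume f : Test →L[ℝ] ℂ)

lemma regular_apply (f : C(ℝ, ℂ)) (φ : Test) : regular f φ = ∫ t, φ t • f t :=
  TestFunction.integralAgainstBilinCLM_eq_integral
    (f.continuous.locallyIntegrable.locallyIntegrableOn _)

/-- The embedding `f ↦ regular f` along which continuous functions are regarded as
distributions. -/
def toDistr : C(ℝ, ℂ) →ₗ[ℂ] Distr where
  toFun := regular
  map_add' f g := by
    ext φ
    have hi (u : C(ℝ, ℂ)) : MeasureTheory.Integrable (fun t ↦ φ t • u t) :=
      (φ.continuous.smul u.continuous).integrable_of_hasCompactSupport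
        φ.hasCompactSupport.smul_right
    change regular (f + g) φ = regular f φ + regular g φ
    simp only [regular_apply, ← MeasureTheory.integral_add (hi f) (hi g), ContinuousMap.add_apply,
      smul_add]
  map_smul' c f := by
    ext φ
    change regular (c • f) φ = c • regular f φ
    simp only [regular_apply, ← MeasureTheory.integral_smul, ContinuousMap.smul_apply,
      smul_comm c]

/-- The function `ℝ → ℂ` of a polynomial with complex coefficients. -/
def polyFun : Polynomial ℂ →ₗ[ℂ] C(ℝ, ℂ) where
  toFun p := ⟨fun t ↦ p.eval (t : ℂ), by fun_prop⟩
  map_add' p q := by ext t; simp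
  map_smul' c p := by ext t; simp

/-- The space `Π` of ordinary polynomials, as functions on `ℝ`. -/
def polynomials : Submodule ℂ C(ℝ, ℂ) := LinearMap.range polyFun

/-- Invariance of a subspace `V` under all members of a family of operators `T h`, `h ∈ ℝ`:
`T_h(V) ⊆ V` for all `h`. -/
def InvariantUnder {X : Type*} [AddCommGroup X] [Module ℂ X] (T : ℝ → Module.End ℂ X)
    (V : Submodule ℂ X) : Prop :=
  ∀ h : ℝ, V.map (T h) ≤ V

/-- `Δ_h^m = (τ_h - 1)^m`, for a family of translation operators `τ`. -/
def diffPow {X : Type*} [AddCommGroup X] [Module ℂ X] (τ : ℝ → Module.End ℂ X) (m : ℕ) (h : ℝ) :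
    Module.End ℂ X :=
  (τ h - 1) ^ m

end DeltaInvariant

end

open DeltaInvariant

namespace DeltaInvariant

/-! ### One-parameter groups in Banach algebras. -/

open Filter Topology NormedSpace

/-! First enlarge `V` to a finite-dimensional translation invariant `W`
(`exists_invariantUnder_ge`); there `τ_h` acts as `exp (h B)` (`exists_generator`). Dividing `(exp
(hB) - 1)^m` by `h^m` and letting `h → 0` gives `B^m V ⊆ V`; the next-order term of the combination
of steps `2h` and `h` gives `B^(m+1) V ⊆ V`. `B` itself need not preserve `V`.

Apply Fitting's lemma to `c = B^m` on `V`: `V = ker c^N ⊕ range c^N`. On the kernel `B` is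
nilpotent, so Taylor series terminate and its elements are polynomials. On the range `c` is
invertible, so `B = B^(m+1) c⁻¹` preserves it, hence so does every `exp (hB)`
(`exists_nilpotent_sup_invariant`).

For distributions, averaging over translations by a test function close to `δ` is invertible on `W`
and turns distributions into continuous functions (`le_range_toDistr_of_invariantUnder`), which
reduces to the first case. -/

/-- A continuous one-parameter group in a Banach algebra is of the form `t ↦ exp (t B)`. -/
theorem exists_eq_exp_smul_of_continuous {𝔸 : Type*} [NormedRing 𝔸] [NormedAlgebra ℝ 𝔸]
    [CompleteSpace 𝔸] {A : ℝ → 𝔸} (hA : Continuous A) (h0 : A 0 = 1)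
    (hadd : ∀ s t, A (s + t) = A s * A t) : ∃ B : 𝔸, ∀ t : ℝ, A t = exp (t • B) := by
  set F : ℝ → 𝔸 := fun s ↦ ∫ t in (0 : ℝ)..s, A t with hF
  have hFd (s : ℝ) : HasDerivAt F (A s) s :=
    intervalIntegral.integral_hasDerivAt_right (hA.intervalIntegrable _ _)
      (hA.stronglyMeasurableAtFilter _ _) hA.continuousAt
  have hslope : Tendsto (fun s ↦ s⁻¹ • F s) (𝓝[≠] 0) (𝓝 1) := by
    have := (hFd 0).tendsto_slope_zero
    simpa [hF, h0] using this
  -- Units are open and the means of `A` over `[0, s]` tend to `1`, so some `F s` is invertible;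
  -- dividing by it expresses `A` through its primitive, hence `A` is differentiable.
  obtain ⟨s, hs, hs0⟩ : ∃ s : ℝ, IsUnit (s⁻¹ • F s) ∧ s ≠ 0 :=
    ((hslope.eventually (Units.isOpen.mem_nhds isUnit_one)).and self_mem_nhdsWithin).exists
  have hu : IsUnit (F s) := by
    have h := hs.smul (Units.mk0 s hs0)
    simpa [Units.smul_def, smul_smul, hs0] using h
  obtain ⟨u, hu⟩ := hu
  have hAF (h : ℝ) : A h = ↑u⁻¹ * (F (s + h) - F h) := by
    rw [Units.eq_inv_mul_iff_mul_eq, hu]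
    have h1 : F (s + h) - F h = ∫ t in (0 : ℝ)..s, A (t + h) := by
      rw [intervalIntegral.integral_comp_add_right, zero_add]
      exact intervalIntegral.integral_interval_sub_left (hA.intervalIntegrable _ _)
        (hA.intervalIntegrable _ _)
    rw [h1]
    simp only [hadd]
    exact (((ContinuousLinearMap.mul ℝ 𝔸).flip (A h)).intervalIntegral_comp_comm
      (hA.intervalIntegrable _ _)).symm
  have hdiff0 : DifferentiableAt ℝ A 0 := by
    have : A = fun h ↦ ↑u⁻¹ * (F (s + h) - F h) := funext hAF
    rw [this]
    have h1 : DifferentiableAt ℝ (fun h ↦ F (s + h)) 0 :=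
      (HasDerivAt.comp_const_add s 0 (hFd (s + 0))).differentiableAt
    exact (h1.sub (hFd 0).differentiableAt).const_mul _
  set B := deriv A 0
  have hder (t : ℝ) : HasDerivAt A (A t * B) t := by
    have h1 : HasDerivAt (fun h ↦ A t * A (h - t)) (A t * B) t := by
      have h2 : HasDerivAt A B (t - t) := by rw [sub_self]; exact hdiff0.hasDerivAt
      exact (h2.comp_sub_const t t).const_mul _
    refine h1.congr_of_eventuallyEq (Eventually.of_forall fun h ↦ ?_)
    simp [← hadd]
  refine ⟨B, fun t ↦ ?_⟩
  have hG (t : ℝ) : HasDerivAt (fun t ↦ A t * exp (t • -B)) 0 t := by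
    have h1 := (hder t).mul (hasDerivAt_exp_smul_const' (𝕂 := ℝ) (-B) t)
    rwa [neg_mul, mul_neg, ← mul_assoc, add_neg_cancel] at h1
  have hc := is_const_of_deriv_eq_zero (fun t ↦ (hG t).differentiableAt)
    (fun t ↦ (hG t).deriv) t 0
  simp only [h0, zero_smul, exp_zero, mul_one] at hc
  rw [smul_neg] at hc
  let _ : NormedAlgebra ℚ 𝔸 := NormedAlgebra.restrictScalars ℚ ℝ 𝔸
  calc A t = A t * exp (-(t • B)) * exp (t • B) := by
        rw [mul_assoc, ← exp_add_of_commute (Commute.neg_left (Commute.refl _))]; simp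
    _ = exp (t • B) := by rw [hc, one_mul]

/-! ### Finite-dimensional subspaces under an abstract translation group. -/

section Abstract

variable {X : Type*} [AddCommGroup X] [Module ℂ X]

/-- Take `V + L V + ⋯ + L^(m-1) V`. The clause on commuting `G` allows the construction to be
repeated for a second operator without losing the first. -/
lemma exists_map_le_of_map_pow_le {L : Module.End ℂ X} {m : ℕ} (hm : 1 ≤ m)
    {V : Submodule ℂ X} [FiniteDimensional ℂ V] (hV : V.map (L ^ m) ≤ V) :
    ∃ W : Submodule ℂ X, FiniteDimensional ℂ W ∧ V ≤ W ∧ W.map L ≤ W ∧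
      ∀ G : Module.End ℂ X, Commute G L → V.map G ≤ V → W.map G ≤ W := by
  refine ⟨⨆ i : Fin m, V.map (L ^ (i : ℕ)), inferInstance, ?_, ?_, fun G hG hGV ↦ ?_⟩
  · refine le_trans ?_ (le_iSup _ (⟨0, hm⟩ : Fin m))
    simp [Module.End.one_eq_id]
  · rw [Submodule.map_iSup]
    refine iSup_le fun i ↦ ?_
    rw [← Submodule.map_comp, ← Module.End.mul_eq_comp, ← pow_succ']
    by_cases hi : (i : ℕ) + 1 < m
    · exact le_iSup (fun i : Fin m ↦ V.map (L ^ (i : ℕ))) ⟨i + 1, hi⟩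
    · have : (i : ℕ) + 1 = m := by omega
      rw [this]
      refine hV.trans (le_trans ?_ (le_iSup _ (⟨0, hm⟩ : Fin m)))
      simp [Module.End.one_eq_id]
  · rw [Submodule.map_iSup]
    refine iSup_le fun i ↦ le_trans ?_ (le_iSup _ i)
    rw [← Submodule.map_comp, ← Module.End.mul_eq_comp, (hG.pow_right i).eq,
      Module.End.mul_eq_comp, Submodule.map_comp]
    exact Submodule.map_mono hGV

-- `Φ` stands in for a topology on `X`: points become families of scalars with the product topology.
variable {τ : ℝ → Module.End ℂ X} {ι : Type*} {Φ : X →ₗ[ℂ] ι → ℂ}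

lemma map_neg_le_of_map_le (h0 : τ 0 = 1) (hadd : ∀ s t, τ (s + t) = τ s * τ t)
    {W : Submodule ℂ X} [FiniteDimensional ℂ W] {h : ℝ} (hW : W.map (τ h) ≤ W) :
    W.map (τ (-h)) ≤ W := by
  have hinj : Function.Injective (τ h) := by
    refine Function.LeftInverse.injective (g := τ (-h)) fun x ↦ ?_
    rw [← Module.End.mul_apply, ← hadd, neg_add_cancel, h0, Module.End.one_apply]
  have heq : W.map (τ h) = W :=
    Submodule.eq_of_le_of_finrank_eq hW (LinearEquiv.finrank_eq
      (Submodule.equivMapOfInjective _ hinj W).symm)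
  conv_lhs => rw [← heq]
  rw [← Submodule.map_comp, ← Module.End.mul_eq_comp, ← hadd, neg_add_cancel, h0,
    Module.End.one_eq_id, Submodule.map_id]

/-- A finite-dimensional subspace that is invariant under all `Δ_h^m` is contained in a
finite-dimensional translation invariant one. -/
lemma exists_invariantUnder_ge (h0 : τ 0 = 1) (hadd : ∀ s t, τ (s + t) = τ s * τ t)
    (hΦ : Function.Injective Φ) (hcont : ∀ x, Continuous fun h ↦ Φ (τ h x))
    {m : ℕ} (hm : 1 ≤ m) {V : Submodule ℂ X} [FiniteDimensional ℂ V]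
    (hV : InvariantUnder (diffPow τ m) V) :
    ∃ W : Submodule ℂ X, FiniteDimensional ℂ W ∧ V ≤ W ∧ InvariantUnder τ W := by
  have hcomm (s t : ℝ) : Commute (τ s - 1) (τ t - 1) := by
    have : Commute (τ s) (τ t) := by
      rw [commute_iff_eq, ← hadd, ← hadd, add_comm]
    exact (this.sub_left (Commute.one_left _)).sub_right (Commute.one_right _)
  -- The steps `1` and `√2` suffice because they generate a dense subgroup of `ℝ`.
  obtain ⟨W₁, hfd₁, hV₁, hL₁, hG₁⟩ := exists_map_le_of_map_pow_le hm (hV 1)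
  obtain ⟨W, hfd, hV₂, hL, hG⟩ := exists_map_le_of_map_pow_le hm
    (hG₁ _ ((hcomm (√2) 1).pow_left m) (hV (√2)))
  have hL' := hG _ (hcomm 1 (√2)) hL₁
  have htau {h : ℝ} (hh : W.map (τ h - 1) ≤ W) : W.map (τ h) ≤ W := by
    rintro _ ⟨x, hx, rfl⟩
    have := W.add_mem (hh ⟨x, hx, rfl⟩) hx
    simpa using this
  refine ⟨W, hfd, hV₁.trans hV₂, fun h ↦ ?_⟩
  let H : AddSubgroup ℝ :=
    { carrier := {h | W.map (τ h) ≤ W}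
      zero_mem' := by simp [h0, Module.End.one_eq_id]
      add_mem' := fun {a b} ha hb ↦ by
        simp only [Set.mem_ofPred_eq] at *
        rw [hadd, Module.End.mul_eq_comp, Submodule.map_comp]
        exact (Submodule.map_mono hb).trans ha
      neg_mem' := fun ha ↦ map_neg_le_of_map_le h0 hadd ha }
  have hdense : Dense (H : Set ℝ) := by
    have h2 : Dense (AddSubgroup.closure {√2, 1} : Set ℝ) :=
      dense_addSubgroupClosure_pair_iff.2 (by simpa using irrational_sqrt_two)
    refine h2.mono ?_
    rw [SetLike.coe_subset_coe, AddSubgroup.closure_le]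
    rintro _ (rfl | rfl)
    · exact htau hL
    · exact htau hL'
  rintro _ ⟨x, hx, rfl⟩
  -- Finite-dimensional subspaces are closed and orbits are continuous, so invariance passes from
  -- the dense subgroup to `ℝ`.
  have hclosed : IsClosed {h : ℝ | Φ (τ h x) ∈ W.map Φ} :=
    (Submodule.closed_of_finiteDimensional (W.map Φ)).preimage (hcont x)
  have hall : {h : ℝ | Φ (τ h x) ∈ W.map Φ} = Set.univ := by
    rw [← Set.univ_subset_iff, ← hdense.closure_eq]
    exact hclosed.closure_subset_iff.2 fun h hh ↦ ⟨_, hh ⟨x, hx, rfl⟩, rfl⟩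
  have : Φ (τ h x) ∈ W.map Φ := by
    have : h ∈ {h : ℝ | Φ (τ h x) ∈ W.map Φ} := hall ▸ Set.mem_univ h
    exact this
  obtain ⟨y, hy, hyx⟩ := this
  exact hΦ hyx ▸ hy

/-- On a finite-dimensional invariant subspace, translation is given by the exponential of
an infinitesimal generator. -/
lemma exists_generator (h0 : τ 0 = 1) (hadd : ∀ s t, τ (s + t) = τ s * τ t)
    (hΦ : Function.Injective Φ) (hcont : ∀ x, Continuous fun h ↦ Φ (τ h x))
    {W : Submodule ℂ X} [FiniteDimensional ℂ W] (hW : InvariantUnder τ W) :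
    ∃ (n : ℕ) (J : (Fin n → ℂ) →ₗ[ℂ] X) (B : (Fin n → ℂ) →L[ℂ] (Fin n → ℂ)),
      Function.Injective J ∧ LinearMap.range J = W ∧
      ∀ (h : ℝ) y, τ h (J y) = J (exp (h • B) y) := by
  let e := (Module.finBasis ℂ W).equivFun
  let J : (Fin (Module.finrank ℂ W) → ℂ) →ₗ[ℂ] X := W.subtype ∘ₗ e.symm.toLinearMap
  have hJ : Function.Injective J := W.injective_subtype.comp e.symm.injective
  have hJr : LinearMap.range J = W := by
    simp [J, LinearMap.range_comp]
  let r (h : ℝ) : W →ₗ[ℂ] W := (τ h).restrict fun x hx ↦ hW h ⟨x, hx, rfl⟩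
  let A (h : ℝ) : (Fin (Module.finrank ℂ W) → ℂ) →L[ℂ] (Fin (Module.finrank ℂ W) → ℂ) :=
    LinearMap.toContinuousLinearMap (e.toLinearMap ∘ₗ r h ∘ₗ e.symm.toLinearMap)
  have hA (h : ℝ) y : τ h (J y) = J (A h y) := by
    simp [J, A, r]
  have hAc : Continuous A := by
    rw [continuous_clm_apply]
    intro y
    have hemb := LinearMap.isClosedEmbedding_of_injective (f := Φ ∘ₗ J)
      (LinearMap.ker_eq_bot.2 (hΦ.comp hJ))
    rw [hemb.isEmbedding.continuous_iff]
    refine (hcont (J y)).congr fun h ↦ ?_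
    simp [hA]
  obtain ⟨B, hB⟩ := exists_eq_exp_smul_of_continuous hAc
    (by ext1 y; apply hJ; rw [← hA]; simp [h0])
    (fun s t ↦ by
      ext1 y; apply hJ
      rw [← hA, hadd, Module.End.mul_apply, hA, hA]; rfl)
  exact ⟨_, J, B, hJ, hJr, fun h y ↦ by rw [hA, hB]⟩

end Abstract

/-! ### Small-step asymptotics of powers of exponential differences. -/

section ExpDifferences

variable {𝔸 : Type*} [NormedRing 𝔸] [NormedAlgebra ℝ 𝔸] [CompleteSpace 𝔸]

lemma tendsto_inv_smul_exp_smul_sub_one (B : 𝔸) :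
    Tendsto (fun h : ℝ ↦ h⁻¹ • (exp (h • B) - 1)) (𝓝[≠] 0) (𝓝 B) := by
  simpa using (hasDerivAt_exp_smul_const (𝕂 := ℝ) B 0).tendsto_slope_zero

lemma tendsto_inv_pow_smul_exp_smul_sub_one_pow (B : 𝔸) (m : ℕ) :
    Tendsto (fun h : ℝ ↦ (h⁻¹) ^ m • (exp (h • B) - 1) ^ m) (𝓝[≠] 0) (𝓝 (B ^ m)) := by
  simpa only [smul_pow] using (tendsto_inv_smul_exp_smul_sub_one B).pow m

/-- With `e = exp (hB)`, `(e² - 1)^m - 2^m (e - 1)^m = (e - 1)^m ((e + 1)^m - 2^m) = (e - 1)^(m+1)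
Q`, where the geometric sum `Q` tends to `m 2^(m-1)`. -/
lemma tendsto_smul_exp_two_smul_sub (B : 𝔸) (m : ℕ) :
    Tendsto (fun h : ℝ ↦ (h⁻¹) ^ (m + 1) •
      ((exp ((2 * h) • B) - 1) ^ m - (2 : ℝ) ^ m • (exp (h • B) - 1) ^ m))
      (𝓝[≠] 0) (𝓝 (((m : ℝ) * 2 ^ (m - 1)) • B ^ (m + 1))) := by
  let _ : NormedAlgebra ℚ 𝔸 := NormedAlgebra.restrictScalars ℚ ℝ 𝔸
  let Q (h : ℝ) : 𝔸 := ∑ i ∈ Finset.range m, (exp (h • B) + 1) ^ i * 2 ^ (m - 1 - i)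
  have hQ : Tendsto Q (𝓝[≠] 0) (𝓝 (((m : ℝ) * 2 ^ (m - 1)) • 1)) := by
    have hc : Continuous Q := by
      have : Continuous fun h : ℝ ↦ exp (h • B) :=
        continuous_iff_continuousAt.2 fun t ↦
          (hasDerivAt_exp_smul_const (𝕂 := ℝ) B t).continuousAt
      fun_prop
    have h0 : Q 0 = ((m : ℝ) * 2 ^ (m - 1)) • 1 := by
      have : ∀ i ∈ Finset.range m,
          (exp ((0 : ℝ) • B) + 1) ^ i * 2 ^ (m - 1 - i) = (2 : 𝔸) ^ (m - 1) := by
        intro i hi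
        rw [Finset.mem_range] at hi
        rw [zero_smul, exp_zero, one_add_one_eq_two, ← pow_add]
        congr 1; omega
      simp only [Q]
      rw [Finset.sum_congr rfl this, ← Algebra.algebraMap_eq_smul_one]
      simp [map_ofNat (algebraMap ℝ 𝔸) 2]
    rw [← h0]
    exact hc.continuousAt.tendsto.mono_left nhdsWithin_le_nhds
  have key := ((tendsto_inv_pow_smul_exp_smul_sub_one_pow B m).mul
    (tendsto_inv_smul_exp_smul_sub_one B)).mul hQ
  rw [← pow_succ, mul_smul_comm, mul_one] at key
  refine key.congr fun h ↦ ?_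
  have h2 : exp ((2 * h) • B) = exp (h • B) * exp (h • B) := by
    rw [two_mul, add_smul, exp_add_of_commute (Commute.refl _)]
  have hc : Commute (exp (h • B) - 1) (exp (h • B) + 1) := by
    rw [commute_iff_eq]; noncomm_ring
  have h3 : exp ((2 * h) • B) - 1 = (exp (h • B) - 1) * (exp (h • B) + 1) := by
    rw [h2]; noncomm_ring
  have h4 : (exp (h • B) - 1) * Q h = (exp (h • B) + 1) ^ m - 2 ^ m := by
    have hcomm : Commute (exp (h • B) + 1) (2 : 𝔸) := Commute.ofNat_right _ 2
    rw [← hcomm.mul_geom_sum₂]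
    congr 1
    rw [← one_add_one_eq_two]; abel
  have h5 : (2 : ℝ) ^ m • (exp (h • B) - 1) ^ m = (exp (h • B) - 1) ^ m * 2 ^ m := by
    rw [Algebra.smul_def, Algebra.commutes]; simp [map_ofNat (algebraMap ℝ 𝔸) 2]
  rw [h3, hc.mul_pow, h5, ← mul_sub, ← h4, pow_succ (h⁻¹)]
  simp only [smul_mul_assoc, mul_smul_comm, smul_smul, mul_assoc]
  rw [mul_comm]

end ExpDifferences

lemma hasSum_exp_smul_apply {Y : Type*} [NormedAddCommGroup Y] [NormedSpace ℂ Y]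
    [CompleteSpace Y] (B : Y →L[ℂ] Y) (h : ℝ) (y : Y) :
    HasSum (fun n : ℕ ↦ ((n.factorial : ℝ)⁻¹ * h ^ n) • (B ^ n) y) (exp (h • B) y) := by
  have h1 := (NormedSpace.exp_series_hasSum_exp' (𝕂 := ℝ) (h • B))
  have h2 := (ContinuousLinearMap.apply ℂ Y y).hasSum h1
  simpa [smul_pow, smul_smul] using h2

/-! ### Fitting decomposition relative to the generator. -/

section FiniteDim

variable {Y : Type*} [NormedAddCommGroup Y] [NormedSpace ℂ Y] [FiniteDimensional ℂ Y]
  {B : Y →L[ℂ] Y} {V : Submodule ℂ Y} {m : ℕ}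

lemma exp_smul_apply_mem (hB : ∀ y ∈ V, B y ∈ V) (h : ℝ) {y : Y} (hy : y ∈ V) :
    exp (h • B) y ∈ V := by
  have := FiniteDimensional.complete ℂ Y
  have hn (n : ℕ) : (B ^ n) y ∈ V := by
    induction n with
    | zero => simpa
    | succ n ih => rw [pow_succ']; exact hB _ ih
  exact V.closed_of_finiteDimensional.mem_of_tendsto (hasSum_exp_smul_apply B h y)
    (Eventually.of_forall fun s ↦ V.sum_mem fun n _ ↦ by
      rw [← Complex.coe_smul]; exact V.smul_mem _ (hn n))

lemma pow_apply_mem_of_exp_sub_one_pow (hV : ∀ h : ℝ, ∀ y ∈ V, ((exp (h • B) - 1) ^ m) y ∈ V)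
    {y : Y} (hy : y ∈ V) : (B ^ m) y ∈ V := by
  have := FiniteDimensional.complete ℂ Y
  refine V.closed_of_finiteDimensional.mem_of_tendsto
    (((ContinuousLinearMap.apply ℂ Y y).continuous.tendsto _).comp
      (tendsto_inv_pow_smul_exp_smul_sub_one_pow B m)) (Eventually.of_forall fun h ↦ ?_)
  simp only [Function.comp, ContinuousLinearMap.apply_apply, SetLike.mem_coe]
  rw [← Complex.coe_smul]
  exact V.smul_mem _ (hV h y hy)

lemma pow_succ_apply_mem_of_exp_sub_one_pow (hm : 1 ≤ m)
    (hV : ∀ h : ℝ, ∀ y ∈ V, ((exp (h • B) - 1) ^ m) y ∈ V)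
    {y : Y} (hy : y ∈ V) : (B ^ (m + 1)) y ∈ V := by
  have := FiniteDimensional.complete ℂ Y
  have key : (((m : ℝ) * 2 ^ (m - 1)) • B ^ (m + 1)) y ∈ V := by
    refine V.closed_of_finiteDimensional.mem_of_tendsto
      (((ContinuousLinearMap.apply ℂ Y y).continuous.tendsto _).comp
        (tendsto_smul_exp_two_smul_sub B m)) (Eventually.of_forall fun h ↦ ?_)
    simp only [Function.comp, ContinuousLinearMap.apply_apply, SetLike.mem_coe]
    rw [← Complex.coe_smul, ← Complex.coe_smul]
    exact V.smul_mem _ (V.sub_mem (hV _ y hy) (V.smul_mem _ (hV _ y hy)))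
  rw [← Complex.coe_smul] at key
  refine (V.smul_mem_iff ?_).1 key
  have : (m : ℝ) * 2 ^ (m - 1) ≠ 0 := by positivity
  exact_mod_cast this

/-- Fitting decomposition of a subspace invariant under all `(exp (h B) - 1) ^ m`. -/
lemma exists_nilpotent_sup_invariant (hm : 1 ≤ m)
    (hV : ∀ h : ℝ, ∀ y ∈ V, ((exp (h • B) - 1) ^ m) y ∈ V) :
    ∃ (P E : Submodule ℂ Y) (k : ℕ), (∀ y ∈ P, (B ^ k) y = 0) ∧ Disjoint P E ∧ P ⊔ E = V ∧
      (∀ (h : ℝ), ∀ y ∈ E, exp (h • B) y ∈ E) ∧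
      ((∀ (h : ℝ), ∀ y ∈ V, exp (h • B) y ∈ V) ↔ ∀ (h : ℝ), ∀ y ∈ P, exp (h • B) y ∈ P) := by
  have hm1 : ∀ y ∈ V, (B ^ m) y ∈ V := fun y hy ↦ pow_apply_mem_of_exp_sub_one_pow hV hy
  have hm2 : ∀ y ∈ V, (B ^ (m + 1)) y ∈ V :=
    fun y hy ↦ pow_succ_apply_mem_of_exp_sub_one_pow hm hV hy
  let c : Module.End ℂ V := ((B ^ m : Y →L[ℂ] Y) : Y →ₗ[ℂ] Y).restrict hm1
  have hc (n : ℕ) (v : V) : ((c ^ n) v : Y) = (B ^ (m * n)) v := by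
    induction n with
    | zero => simp
    | succ n ih => rw [pow_succ', Module.End.mul_apply, mul_add, mul_one, add_comm, pow_add]
                   exact congrArg (B ^ m) ih
  -- `N ≥ 1` leaves one factor `c` to be merged with `B` below.
  obtain ⟨N, hN, hN1⟩ :=
    (c.eventually_isCompl_ker_pow_range_pow.and (eventually_ge_atTop 1)).exists
  let P : Submodule ℂ Y := (LinearMap.ker (c ^ N)).map V.subtype
  let E : Submodule ℂ Y := (LinearMap.range (c ^ N)).map V.subtype
  have hP {y : Y} : y ∈ P ↔ y ∈ V ∧ (B ^ (m * N)) y = 0 := by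
    constructor
    · rintro ⟨v, hv, rfl⟩
      refine ⟨v.2, ?_⟩
      rw [SetLike.mem_coe, LinearMap.mem_ker] at hv
      rw [Submodule.subtype_apply, ← hc, hv, Submodule.coe_zero]
    · rintro ⟨hy, h0⟩
      refine ⟨⟨y, hy⟩, ?_, rfl⟩
      rw [SetLike.mem_coe, LinearMap.mem_ker]
      exact Subtype.ext ((hc N ⟨y, hy⟩).trans h0)
  have hE {y : Y} : y ∈ E ↔ ∃ v ∈ V, (B ^ (m * N)) v = y := by
    constructor
    · rintro ⟨_, ⟨v, rfl⟩, rfl⟩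
      exact ⟨v, v.2, (hc N v).symm⟩
    · rintro ⟨v, hv, rfl⟩
      exact ⟨_, ⟨⟨v, hv⟩, rfl⟩, hc N ⟨v, hv⟩⟩
  have hsup : P ⊔ E = V := by
    rw [← Submodule.map_sup, hN.sup_eq_top, Submodule.map_top, Submodule.range_subtype]
  have hEB : ∀ y ∈ E, B y ∈ E := by
    rintro _ ⟨_, ⟨v, rfl⟩, rfl⟩
    -- The kernel part of `v` dies, so the element is `c^(2N) w`, and `B c^(2N) w = c^N (B^(m+1)
    -- c^(N-1) w)`.
    have hv : v ∈ LinearMap.ker (c ^ N) ⊔ LinearMap.range (c ^ N) :=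
      hN.sup_eq_top ▸ Submodule.mem_top
    obtain ⟨p, hp, _, ⟨w, rfl⟩, rfl⟩ := Submodule.mem_sup.1 hv
    rw [map_add, LinearMap.mem_ker.1 hp, zero_add, ← Module.End.mul_apply, ← pow_add,
      Submodule.subtype_apply, hE]
    obtain ⟨M, hM⟩ : ∃ M, N = M + 1 := ⟨N - 1, by omega⟩
    refine ⟨_, hm2 _ ((c ^ M) w).2, ?_⟩
    simp only [hc, ← mul_apply_eq_comp, ← pow_add]
    rw [← pow_succ']
    congr 2
    rw [hM]; ring
  have hEexp : ∀ (h : ℝ), ∀ y ∈ E, exp (h • B) y ∈ E := fun h y hy ↦ exp_smul_apply_mem hEB h hy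
  refine ⟨P, E, m * N, fun y hy ↦ (hP.1 hy).2, ?_, hsup, hEexp, fun H h y hy ↦ ?_,
    fun H h y hy ↦ ?_⟩
  · exact (Submodule.disjoint_map V.injective_subtype hN.disjoint)
  · obtain ⟨hyV, hy0⟩ := hP.1 hy
    refine hP.2 ⟨H h y hyV, ?_⟩
    have hcomm : Commute (B ^ (m * N)) (exp (h • B)) :=
      (((Commute.refl B).smul_right h).pow_left _).exp_right
    rw [← mul_apply_eq_comp, hcomm.eq, mul_apply_eq_comp, hy0, map_zero]
  · rw [← hsup] at hy ⊢
    obtain ⟨p, hp, e, he, rfl⟩ := Submodule.mem_sup.1 hy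
    rw [map_add]
    exact Submodule.add_mem_sup (H h p hp) (hEexp h e he)

end FiniteDim

/-! ### Spaces of continuous functions. -/

lemma translateFun_zero : translateFun 0 = 1 := by
  ext f t
  simp [translateFun]

lemma translateFun_add (s t : ℝ) : translateFun (s + t) = translateFun s * translateFun t := by
  ext f x
  change f (x + (s + t)) = f (x + s + t)
  rw [add_assoc]

/-- A function as the family of its values. -/
noncomputable def coeFun : C(ℝ, ℂ) →ₗ[ℂ] ℝ → ℂ where
  toFun f := f
  map_add' _ _ := rfl
  map_smul' _ _ := rfl

lemma coeFun_injective : Function.Injective coeFun := DFunLike.coe_injective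

lemma continuous_coeFun_translateFun (f : C(ℝ, ℂ)) :
    Continuous fun h ↦ coeFun (translateFun h f) :=
  continuous_pi fun _ ↦ f.continuous.comp (continuous_const.add continuous_id)

/-- The value at `h` is the value at `0` of the translate by `h`, and the exponential series of that
translate stops before `k`. -/
lemma mem_polynomials_of_pow_apply_eq_zero {n : ℕ} {J : (Fin n → ℂ) →ₗ[ℂ] C(ℝ, ℂ)}
    {B : (Fin n → ℂ) →L[ℂ] (Fin n → ℂ)} (hJ : ∀ (h : ℝ) y, translateFun h (J y) = J (exp (h • B) y))
    {k : ℕ} {y : Fin n → ℂ} (hy : (B ^ k) y = 0) : J y ∈ polynomials := by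
  refine ⟨∑ j ∈ Finset.range k,
    Polynomial.C ((j.factorial : ℂ)⁻¹ * J ((B ^ j) y) 0) * Polynomial.X ^ j, ?_⟩
  ext h
  have h1 : exp (h • B) y = ∑ j ∈ Finset.range k, ((j.factorial : ℝ)⁻¹ * h ^ j) • (B ^ j) y := by
    refine (hasSum_exp_smul_apply B h y).unique (hasSum_sum_of_ne_finset_zero fun j hj ↦ ?_)
    rw [Finset.mem_range, not_lt] at hj
    rw [← Nat.sub_add_cancel hj, pow_add B, mul_apply_eq_comp, hy, map_zero, smul_zero]
  have h2 : J y h = translateFun h (J y) 0 := by simp [translateFun]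
  rw [h2, hJ, h1, map_sum]
  simp only [← Complex.coe_smul]
  simp [polyFun]
  refine Finset.sum_congr rfl fun j _ ↦ ?_
  ring

lemma map_diffPow_eq {X Y : Type*} [AddCommGroup X] [Module ℂ X] [AddCommGroup Y] [Module ℂ Y]
    {S : Module.End ℂ Y} {T : Module.End ℂ X} {J : Y →ₗ[ℂ] X} (hJ : ∀ y, T (J y) = J (S y))
    (m : ℕ) (y : Y) : ((T - 1) ^ m) (J y) = J (((S - 1) ^ m) y) := by
  induction m generalizing y with
  | zero => simp
  | succ m ih =>
    rw [pow_succ, pow_succ, Module.End.mul_apply, Module.End.mul_apply, ← ih]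
    simp [hJ]

/-- The decomposition theorem for finite-dimensional spaces of continuous functions. -/
theorem exists_polynomials_sup_invariant {m : ℕ} (hm : 1 ≤ m) {V : Submodule ℂ C(ℝ, ℂ)}
    (hfd : FiniteDimensional ℂ V) (hV : InvariantUnder (diffPow translateFun m) V) :
    ∃ P E : Submodule ℂ C(ℝ, ℂ), P ≤ polynomials ∧
        Disjoint P E ∧ P ⊔ E = V ∧
        InvariantUnder translateFun E ∧
        (InvariantUnder translateFun V ↔ InvariantUnder translateFun P) := by
  obtain ⟨W, hWfd, hVW, hW⟩ := exists_invariantUnder_ge translateFun_zero translateFun_add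
    coeFun_injective continuous_coeFun_translateFun hm hV
  obtain ⟨n, J, B, hJinj, rfl, hJ⟩ := exists_generator translateFun_zero translateFun_add
    coeFun_injective continuous_coeFun_translateFun hW
  have hmap : (V.comap J).map J = V := by
    rw [Submodule.map_comap_eq, inf_eq_right]; exact hVW
  have hinv (U : Submodule ℂ (Fin n → ℂ)) : InvariantUnder translateFun (U.map J) ↔
      ∀ (h : ℝ), ∀ y ∈ U, exp (h • B) y ∈ U := by
    refine forall_congr' fun h ↦ ⟨fun H y hy ↦ ?_, ?_⟩
    · have h1 := H ⟨J y, ⟨y, hy, rfl⟩, rfl⟩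
      rw [hJ] at h1
      obtain ⟨z, hz, hzy⟩ := h1
      exact hJinj hzy ▸ hz
    · rintro H _ ⟨_, ⟨y, hy, rfl⟩, rfl⟩
      exact ⟨_, H y hy, (hJ h y).symm⟩
  obtain ⟨P, E, k, hPk, hdisj, hsup, hE, hiff⟩ :=
    exists_nilpotent_sup_invariant (B := B) (V := V.comap J) hm fun h y hy ↦ by
      rw [Submodule.mem_comap]
      have h1 := map_diffPow_eq (S := (exp (h • B) : (Fin n → ℂ) →L[ℂ] (Fin n → ℂ)).toLinearMap)
        (hJ h) m y
      have h2 : (((exp (h • B) : (Fin n → ℂ) →L[ℂ] (Fin n → ℂ)).toLinearMap - 1) ^ m) y =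
          ((exp (h • B) - 1) ^ m) y := by
        rw [← ContinuousLinearMap.coe_coe ((exp (h • B) - 1) ^ m)]
        simp [ContinuousLinearMap.toLinearMap_pow]
      rw [← h2, ← h1]
      exact hV h ⟨_, hy, rfl⟩
  refine ⟨P.map J, E.map J, ?_, Submodule.disjoint_map hJinj hdisj, ?_, (hinv E).2 hE, ?_⟩
  · rintro _ ⟨y, hy, rfl⟩
    exact mem_polynomials_of_pow_apply_eq_zero hJ (hPk y hy)
  · rw [← Submodule.map_sup, hsup, hmap]
  · rw [hinv, ← hiff, ← hinv, hmap]

/-! ### Distributions: continuity of translation and smoothing by convolution. -/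

open MeasureTheory Convolution
open scoped BoundedContinuousFunction ContDiff

lemma hasCompactSupport_iteratedDeriv {f : ℝ → ℝ} (hf : HasCompactSupport f) (i : ℕ) :
    HasCompactSupport (iteratedDeriv i f) := by
  induction i with
  | zero => simpa
  | succ i ih => rw [iteratedDeriv_succ]; exact ih.deriv

lemma contDiff_test (φ : Test) : ContDiff ℝ ∞ φ := φ.contDiff

lemma continuous_iteratedDeriv_test (φ : Test) (i : ℕ) : Continuous (iteratedDeriv i φ) :=
  (contDiff_test φ).continuous_iteratedDeriv i (by exact_mod_cast le_top)

/-- The derivatives of order at most `N` of a test function, as a linear map to a Banach space. -/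
noncomputable def jet (N : ℕ) : Test →ₗ[ℝ] (Fin (N + 1) → (ℝ →ᵇ ℝ)) where
  toFun φ i :=
    { toFun := iteratedDeriv i φ
      continuous_toFun := continuous_iteratedDeriv_test φ i
      map_bounded' := by
        obtain ⟨C, hC⟩ := (continuous_iteratedDeriv_test φ i).bounded_above_of_compact_support
          (hasCompactSupport_iteratedDeriv φ.hasCompactSupport i)
        exact ⟨C + C, fun x y ↦ (dist_le_norm_add_norm _ _).trans (add_le_add (hC x) (hC y))⟩ }
  map_add' φ ψ := by
    ext i t
    exact iteratedDeriv_add ((contDiff_test φ).of_le (by exact_mod_cast le_top)).contDiffAt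
      ((contDiff_test ψ).of_le (by exact_mod_cast le_top)).contDiffAt
  map_smul' c φ := by
    ext i t
    exact iteratedDeriv_const_smul ((contDiff_test φ).of_le (by exact_mod_cast le_top)).contDiffAt c

lemma jet_apply (N : ℕ) (φ : Test) (i : Fin (N + 1)) (t : ℝ) :
    jet N φ i t = iteratedDeriv i φ t := rfl

lemma jet_injective (N : ℕ) : Function.Injective (jet N) := by
  intro φ ψ h
  ext t
  have := DFunLike.congr_fun (congrFun h 0) t
  simpa [jet_apply] using this

lemma translateTest_apply (h : ℝ) (φ : Test) (t : ℝ) : translateTest h φ t = φ (t + h) := rfl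

lemma jet_translateTest (N : ℕ) (h : ℝ) (φ : Test) (i : Fin (N + 1)) (t : ℝ) :
    jet N (translateTest h φ) i t = jet N φ i (t + h) := by
  rw [jet_apply, jet_apply]
  exact congrFun (iteratedDeriv_comp_add_const i φ h) t

lemma continuous_jet_translateTest (N : ℕ) (φ : Test) :
    Continuous fun h ↦ jet N (translateTest h φ) := by
  refine continuous_pi fun i ↦ Metric.continuous_iff.2 fun h ε hε ↦ ?_
  have huc : UniformContinuous (iteratedDeriv i φ) :=
    (hasCompactSupport_iteratedDeriv φ.hasCompactSupport i).uniformContinuous_of_continuous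
      (continuous_iteratedDeriv_test φ i)
  obtain ⟨δ, hδ, H⟩ := Metric.uniformContinuous_iff.1 huc (ε / 2) (half_pos hε)
  refine ⟨δ, hδ, fun h' hh' ↦ lt_of_le_of_lt ?_ (half_lt_self hε)⟩
  refine (BoundedContinuousFunction.dist_le (half_pos hε).le).2 fun t ↦ ?_
  rw [jet_translateTest, jet_translateTest]
  exact (H (by simpa using hh')).le

/-- On test functions supported in a fixed compact set, a distribution is a continuous
functional of finitely many derivatives. -/
lemma exists_eq_comp_jet (T : Distr) (K : Compacts ℝ) :
    ∃ (N : ℕ) (L : (Fin (N + 1) → (ℝ →ᵇ ℝ)) →L[ℝ] ℂ),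
      ∀ φ : Test, (∀ x ∉ K, φ x = 0) → T φ = L (jet N φ) := by
  let I : 𝓓^{⊤}_{K}(ℝ, ℝ) →L[ℝ] Test := TestFunction.ofSupportedInCLM ℝ fun _ _ ↦ trivial
  let f : 𝓓^{⊤}_{K}(ℝ, ℝ) →ₗ[ℝ] ℂ :=
    { toFun := fun φ ↦ T (I φ)
      map_add' := fun φ ψ ↦ by rw [map_add, map_add]
      map_smul' := fun c φ ↦ by rw [map_smul, map_smul]; rfl }
  have hf : Continuous f := (map_continuous T).comp I.continuous
  obtain ⟨s, C, -, hC⟩ := Seminorm.bound_of_continuous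
    (ContDiffMapSupportedIn.withSeminorms ℝ ℝ ℝ ⊤ K) ((normSeminorm ℝ ℂ).comp f) hf.norm
  let N := s.sup id
  let g : 𝓓^{⊤}_{K}(ℝ, ℝ) →ₗ[ℝ] (Fin (N + 1) → (ℝ →ᵇ ℝ)) := jet N ∘ₗ I.toLinearMap
  have hg : Function.Injective g := by
    refine (jet_injective N).comp fun φ ψ h ↦ ?_
    ext t
    exact DFunLike.congr_fun h t
  have hbound (φ) : ‖f φ‖ ≤ C * ‖g φ‖ := by
    refine (hC φ).trans ?_
    change (C : ℝ) * _ ≤ _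
    refine mul_le_mul_of_nonneg_left ?_ C.2
    refine Seminorm.finset_sup_apply_le (norm_nonneg _) fun i hi ↦ ?_
    refine (ContDiffMapSupportedIn.seminorm_top_le_iff ℝ (norm_nonneg _) i φ).2 fun t ht ↦ ?_
    rw [norm_iteratedFDeriv_eq_norm_iteratedDeriv]
    have hiN : i < N + 1 := Nat.lt_succ_of_le (Finset.le_sup (f := id) hi)
    exact ((g φ ⟨i, hiN⟩).norm_coe_le_norm t).trans (norm_le_pi_norm (g φ) ⟨i, hiN⟩)
  -- The bound makes `f` a bounded functional on the range of `g`; Hahn–Banach extends it to the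
  -- Banach space of jets.
  let e := LinearEquiv.ofInjective g hg
  let F₀ : LinearMap.range g →ₗ[ℝ] ℂ := f ∘ₗ e.symm.toLinearMap
  have hF₀ (φ) : F₀ (e φ) = f φ := congrArg f (e.symm_apply_apply φ)
  have hF₀C (y) : ‖F₀ y‖ ≤ C * ‖y‖ := by
    obtain ⟨φ, rfl⟩ := e.surjective y
    rw [hF₀]
    exact hbound φ
  let F : LinearMap.range g →L[ℝ] ℂ :=
    ⟨F₀, AddMonoidHomClass.continuous_of_bound F₀ C hF₀C⟩
  obtain ⟨L, hL⟩ := F.exist_extension_of_finiteDimensional_range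
  refine ⟨N, L, fun φ hφ ↦ ?_⟩
  let φK : 𝓓^{⊤}_{K}(ℝ, ℝ) := ⟨φ, φ.contDiff, fun x hx ↦ hφ x hx⟩
  have h1 : f φK = F (e φK) := (hF₀ φK).symm
  rw [hL] at h1
  exact h1

lemma translateDistr_apply (h : ℝ) (T : Distr) (φ : Test) :
    translateDistr h T φ = T (translateTest (-h) φ) := rfl

lemma exists_forall_lt_abs_eq_zero (φ : Test) : ∃ R, ∀ x, R < |x| → φ x = 0 := by
  obtain ⟨R, hR⟩ := φ.hasCompactSupport.isCompact.isBounded.subset_closedBall 0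
  refine ⟨R, fun x hx ↦ ?_⟩
  by_contra h
  have := hR (subset_tsupport _ h)
  rw [mem_closedBall_zero_iff, Real.norm_eq_abs] at this
  linarith

lemma continuous_translateDistr_apply (T : Distr) (φ : Test) :
    Continuous fun h ↦ translateDistr h T φ := by
  rw [continuous_iff_continuousAt]
  intro h₀
  obtain ⟨R, hR⟩ := exists_forall_lt_abs_eq_zero φ
  -- This ball contains the supports of all translates of `φ` by `-h` with `|h - h₀| < 1`.
  obtain ⟨N, L, hL⟩ := exists_eq_comp_jet T
    ⟨Metric.closedBall 0 (R + |h₀| + 1), isCompact_closedBall _ _⟩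
  have hc : Continuous fun h : ℝ ↦ L (jet N (translateTest (-h) φ)) :=
    L.continuous.comp ((continuous_jet_translateTest N φ).comp continuous_neg)
  refine hc.continuousAt.congr ?_
  filter_upwards [Metric.ball_mem_nhds h₀ one_pos] with h hh
  rw [translateDistr_apply]
  refine (hL _ fun x hx ↦ ?_).symm
  rw [translateTest_apply]
  refine hR _ ?_
  have hx' : R + |h₀| + 1 < |x| := by
    by_contra hcon
    exact hx (mem_closedBall_zero_iff.2 (not_lt.1 hcon))
  rw [Metric.mem_ball, Real.dist_eq] at hh
  have h1 := abs_sub_abs_le_abs_sub h h₀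
  have h2 := abs_sub_abs_le_abs_sub x h
  rw [← sub_eq_add_neg]
  linarith

/-- Convolution of test functions. -/
noncomputable def testConv (ψ φ : Test) : Test where
  toFun := ψ ⋆[ContinuousLinearMap.lsmul ℝ ℝ, volume] φ
  contDiff' := φ.hasCompactSupport.contDiff_convolution_right _
    ψ.continuous.locallyIntegrable φ.contDiff
  hasCompactSupport' := ψ.hasCompactSupport.convolution _ φ.hasCompactSupport
  tsupport_subset' := fun _ _ ↦ trivial

lemma testConv_apply (ψ φ : Test) (t : ℝ) : testConv ψ φ t = ∫ h, ψ h • φ (t - h) := rfl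

lemma testConv_comm (ψ φ : Test) : testConv ψ φ = testConv φ ψ := by
  ext t
  change (ψ ⋆[ContinuousLinearMap.lsmul ℝ ℝ, volume] φ) t = _
  rw [convolution_lsmul_swap, testConv_apply]
  simp [mul_comm]

lemma iteratedDeriv_testConv (ψ φ : Test) (i : ℕ) :
    iteratedDeriv i (testConv ψ φ) =
      ψ ⋆[ContinuousLinearMap.lsmul ℝ ℝ, volume] iteratedDeriv i φ := by
  induction i with
  | zero => simp only [iteratedDeriv_zero]; rfl
  | succ i ih =>
    rw [iteratedDeriv_succ, ih, iteratedDeriv_succ]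
    ext t
    refine (HasCompactSupport.hasDerivAt_convolution_right _ ψ.continuous.locallyIntegrable
      (hasCompactSupport_iteratedDeriv φ.hasCompactSupport i) ?_ t).deriv
    rw [iteratedDeriv_eq_iterate]
    exact ContDiff.iterate_deriv' 1 i ((contDiff_test φ).of_le (by exact_mod_cast le_top))

lemma integral_smul_jet_translateTest (ψ φ : Test) (N : ℕ) :
    ∫ h, ψ h • jet N (translateTest (-h) φ) = jet N (testConv ψ φ) := by
  have hint : Integrable fun h ↦ ψ h • jet N (translateTest (-h) φ) :=
    (ψ.continuous.smul ((continuous_jet_translateTest N φ).comp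
      continuous_neg)).integrable_of_hasCompactSupport ψ.hasCompactSupport.smul_right
  ext i t
  let ev : (Fin (N + 1) → (ℝ →ᵇ ℝ)) →L[ℝ] ℝ :=
    BoundedContinuousFunction.evalCLM ℝ t ∘L ContinuousLinearMap.proj i
  refine (ev.integral_comp_comm hint).symm.trans ?_
  rw [jet_apply, iteratedDeriv_testConv, convolution_lsmul]
  refine integral_congr_ae (Eventually.of_forall fun h ↦ ?_)
  change ψ h • jet N (translateTest (-h) φ) i t = _
  rw [jet_translateTest, ← sub_eq_add_neg, jet_apply]

/-- Through a functional on jets, `T` commutes with a Bochner integral of translates of `φ`, which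
is the jet of the convolution. -/
lemma integral_smul_translateDistr (T : Distr) (ψ φ : Test) :
    ∫ h, ψ h • translateDistr h T φ = T (testConv ψ φ) := by
  obtain ⟨R, hR⟩ := exists_forall_lt_abs_eq_zero φ
  obtain ⟨S, hS⟩ := exists_forall_lt_abs_eq_zero ψ
  obtain ⟨N, L, hL⟩ := exists_eq_comp_jet T ⟨Metric.closedBall 0 (R + S), isCompact_closedBall _ _⟩
  have hout {x : ℝ} (hx : x ∉ (⟨Metric.closedBall 0 (R + S), isCompact_closedBall _ _⟩ :
      Compacts ℝ)) (h : ℝ) (hh : ψ h ≠ 0) : φ (x - h) = 0 := by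
    refine hR _ ?_
    have hx' : R + S < |x| := by
      by_contra hcon
      exact hx (mem_closedBall_zero_iff.2 (not_lt.1 hcon))
    have h1 : |h| ≤ S := not_lt.1 fun hlt ↦ hh (hS h hlt)
    have h2 := abs_sub_abs_le_abs_sub x h
    linarith
  have hint : Integrable fun h ↦ ψ h • jet N (translateTest (-h) φ) :=
    (ψ.continuous.smul ((continuous_jet_translateTest N φ).comp
      continuous_neg)).integrable_of_hasCompactSupport ψ.hasCompactSupport.smul_right
  rw [hL (testConv ψ φ) fun x hx ↦ ?_, ← integral_smul_jet_translateTest,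
    ← L.integral_comp_comm hint]
  · refine integral_congr_ae (Eventually.of_forall fun h ↦ ?_)
    by_cases hh : ψ h = 0
    · simp [hh]
    · simp only [map_smul]
      rw [translateDistr_apply, hL _ fun x hx ↦ ?_]
      rw [translateTest_apply, ← sub_eq_add_neg]
      exact hout hx h hh
  · rw [testConv_apply]
    refine integral_eq_zero_of_ae (Eventually.of_forall fun h ↦ ?_)
    by_cases hh : ψ h = 0
    · simp [hh]
    · simp [hout hx h hh]

lemma integral_smul_translateDistr_comm (T : Distr) (ψ φ : Test) :
    ∫ h, ψ h • translateDistr h T φ = ∫ h, φ h • translateDistr h T ψ := by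
  rw [integral_smul_translateDistr, integral_smul_translateDistr, testConv_comm]

lemma translateDistr_zero : translateDistr 0 = 1 := by
  ext T φ
  change T (translateTest (-0) φ) = T φ
  congr 1
  ext t
  simp [translateTest_apply]

lemma translateDistr_add (s t : ℝ) :
    translateDistr (s + t) = translateDistr s * translateDistr t := by
  ext T φ
  change T (translateTest (-(s + t)) φ) = T (translateTest (-t) (translateTest (-s) φ))
  congr 1
  ext x
  simp only [translateTest_apply]
  congr 1
  ring

/-- A distribution as the family of its values at test functions. -/
noncomputable def coeDistr : Distr →ₗ[ℂ] Test → ℂ where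
  toFun T φ := T φ
  map_add' _ _ := rfl
  map_smul' _ _ := rfl

lemma coeDistr_injective : Function.Injective coeDistr := DFunLike.coe_injective

lemma continuous_coeDistr_translateDistr (T : Distr) :
    Continuous fun h ↦ coeDistr (translateDistr h T) :=
  continuous_pi fun φ ↦ continuous_translateDistr_apply T φ

lemma toDistr_apply (f : C(ℝ, ℂ)) (φ : Test) : toDistr f φ = ∫ t, φ t • f t := regular_apply f φ

lemma toDistr_injective : Function.Injective toDistr := by
  rw [← LinearMap.ker_eq_bot, LinearMap.ker_eq_bot']
  intro f hf
  have hae : ∀ᵐ x, f x = 0 := by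
    refine ae_eq_zero_of_integral_contDiff_smul_eq_zero f.continuous.locallyIntegrable
      fun g hg hgc ↦ ?_
    let φ : Test := ⟨g, hg, hgc, fun _ _ ↦ trivial⟩
    have h1 := toDistr_apply f φ
    rw [hf] at h1
    exact h1.symm
  ext x
  exact congrFun (Continuous.ae_eq_iff_eq volume f.continuous continuous_const |>.1 hae) x

lemma translateDistr_toDistr (h : ℝ) (f : C(ℝ, ℂ)) :
    translateDistr h (toDistr f) = toDistr (translateFun h f) := by
  ext φ
  rw [translateDistr_apply, toDistr_apply, toDistr_apply,
    ← integral_add_right_eq_self _ h]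
  simp [translateTest_apply, translateFun]

/-- For an approximate identity `ψ` the integral tends to `A 0 = 1`, and units are open. -/
lemma exists_isUnit_integral_smul {𝔸 : Type*} [NormedRing 𝔸] [NormedAlgebra ℝ 𝔸]
    [CompleteSpace 𝔸] {A : ℝ → 𝔸} (hA : Continuous A) (h0 : A 0 = 1) :
    ∃ ψ : Test, IsUnit (∫ h, ψ h • A h) := by
  let b (n : ℕ) : ContDiffBump (0 : ℝ) :=
    ⟨1 / ((n : ℝ) + 1) / 2, 1 / ((n : ℝ) + 1), by positivity, half_lt_self (by positivity)⟩
  have hb : Tendsto (fun n ↦ (b n).rOut) atTop (𝓝 0) := tendsto_one_div_add_atTop_nhds_zero_nat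
  have hlim := ContDiffBump.convolution_tendsto_right_of_continuous (μ := volume) hb
    (hA.comp continuous_neg) 0
  simp only [Function.comp, neg_zero, h0, convolution_lsmul, zero_sub, neg_neg] at hlim
  obtain ⟨n, hn⟩ := (hlim.eventually (Units.isOpen.mem_nhds isUnit_one)).exists
  exact ⟨⟨(b n).normed volume, (b n).contDiff_normed, (b n).hasCompactSupport_normed,
    fun _ _ ↦ trivial⟩, hn⟩

lemma integral_smul_apply {Y : Type*} [NormedAddCommGroup Y] [NormedSpace ℂ Y]
    [FiniteDimensional ℂ Y] {A : ℝ → Y →L[ℂ] Y} (hA : Continuous A) (ψ : Test)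
    (l : Y →ₗ[ℂ] ℂ) (y : Y) : ∫ h, ψ h • l (A h y) = l ((∫ h, ψ h • A h) y) := by
  have := FiniteDimensional.complete ℂ Y
  have hint : Integrable fun h ↦ ψ h • A h :=
    (ψ.continuous.smul hA).integrable_of_hasCompactSupport ψ.hasCompactSupport.smul_right
  have h1 := (LinearMap.toContinuousLinearMap l ∘L
    ContinuousLinearMap.apply ℂ Y y).integral_comp_comm hint
  refine Eq.trans (integral_congr_ae (Eventually.of_forall fun h ↦ ?_)) h1
  simp [← Complex.coe_smul]

/-- A finite-dimensional translation invariant space of distributions consists of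
continuous functions. -/
lemma le_range_toDistr_of_invariantUnder {W : Submodule ℂ Distr} [FiniteDimensional ℂ W]
    (hW : InvariantUnder translateDistr W) : W ≤ LinearMap.range toDistr := by
  obtain ⟨n, J, B, hJinj, rfl, hJ⟩ := exists_generator translateDistr_zero translateDistr_add
    coeDistr_injective continuous_coeDistr_translateDistr hW
  have hexp : Continuous fun h : ℝ ↦ exp (h • B) :=
    continuous_iff_continuousAt.2 fun t ↦ (hasDerivAt_exp_smul_const (𝕂 := ℝ) B t).continuousAt
  obtain ⟨ψ, hψ⟩ := exists_isUnit_integral_smul hexp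
    ((congrArg exp (zero_smul ℝ B)).trans exp_zero)
  obtain ⟨u, hu⟩ := hψ
  rintro _ ⟨y, rfl⟩
  obtain ⟨z, hz⟩ : ∃ z, (u : (Fin n → ℂ) →L[ℂ] (Fin n → ℂ)) z = y :=
    ⟨(↑u⁻¹ : (Fin n → ℂ) →L[ℂ] (Fin n → ℂ)) y, by
      rw [← mul_apply_eq_comp, Units.mul_inv, one_apply_eq_self]⟩
  -- Since `y = u z`, `J y` is the `ψ`-average of the translates of `J z`; symmetry of convolution
  -- exchanges `ψ` and `φ`, exhibiting this function as its density.
  refine ⟨⟨fun h ↦ translateDistr h (J z) ψ, continuous_translateDistr_apply _ _⟩, ?_⟩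
  ext φ
  rw [toDistr_apply]
  change ∫ h, φ h • translateDistr h (J z) ψ = _
  rw [← integral_smul_translateDistr_comm]
  simp only [hJ]
  refine (integral_smul_apply hexp ψ (LinearMap.proj φ ∘ₗ coeDistr ∘ₗ J) z).trans ?_
  rw [← hu, hz]
  rfl

end DeltaInvariant

theorem theorem3p1 (m : ℕ) (hm : 1 ≤ m) :
    (∀ V : Submodule ℂ C(ℝ, ℂ), FiniteDimensional ℂ V →
      InvariantUnder (diffPow translateFun m) V →
      ∃ P E : Submodule ℂ C(ℝ, ℂ), P ≤ polynomials ∧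
        Disjoint P E ∧ P ⊔ E = V ∧
        InvariantUnder translateFun E ∧
        (InvariantUnder translateFun V ↔ InvariantUnder translateFun P)) ∧
    (∀ V : Submodule ℂ Distr, FiniteDimensional ℂ V →
      InvariantUnder (diffPow translateDistr m) V →
      ∃ P E : Submodule ℂ C(ℝ, ℂ), P ≤ polynomials ∧
        Disjoint (P.map toDistr) (E.map toDistr) ∧ P.map toDistr ⊔ E.map toDistr = V ∧
        InvariantUnder translateFun E ∧
        (InvariantUnder translateDistr V ↔ InvariantUnder translateFun P)) := by
  refine ⟨fun V hfd hV ↦ exists_polynomials_sup_invariant hm hfd hV, fun V hfd hV ↦ ?_⟩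
  obtain ⟨W, hWfd, hVW, hW⟩ := exists_invariantUnder_ge translateDistr_zero translateDistr_add
    coeDistr_injective continuous_coeDistr_translateDistr hm hV
  -- `V` lies in `W`, which consists of continuous functions, so `V` is the image of its preimage.
  have hmap : (V.comap toDistr).map toDistr = V := by
    rw [Submodule.map_comap_eq, inf_eq_right]
    exact hVW.trans (le_range_toDistr_of_invariantUnder hW)
  have hfd' : FiniteDimensional ℂ (V.comap toDistr) := by
    have : FiniteDimensional ℂ ((V.comap toDistr).map toDistr) := by rwa [hmap]
    exact LinearEquiv.finiteDimensional
      (Submodule.equivMapOfInjective _ toDistr_injective (V.comap toDistr)).symm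
  obtain ⟨P, E, hP, hdisj, hsup, hE, hiff⟩ := exists_polynomials_sup_invariant hm hfd'
    (V := V.comap toDistr) (by
      rintro h _ ⟨f, hf, rfl⟩
      rw [Submodule.mem_comap, diffPow, ← map_diffPow_eq (translateDistr_toDistr h)]
      exact hV h ⟨_, hf, rfl⟩)
  refine ⟨P, E, hP, Submodule.disjoint_map toDistr_injective hdisj, ?_, hE, ?_⟩
  · rw [← Submodule.map_sup, hsup, hmap]
  · rw [← hiff]
    refine forall_congr' fun h ↦ ⟨?_, fun H ↦ ?_⟩
    · rintro H _ ⟨f, hf, rfl⟩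
      rw [Submodule.mem_comap, ← translateDistr_toDistr]
      exact H ⟨_, hf, rfl⟩
    · rw [← hmap]
      rintro _ ⟨_, ⟨f, hf, rfl⟩, rfl⟩
      rw [translateDistr_toDistr]
      exact ⟨_, H ⟨f, hf, rfl⟩, rfl⟩
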